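/- For an integrable function $f\colon\mathbb{R}^n\to\mathbb{R}$ let $\widehat f(t)=\int_{\mathbb{R}^n} f(x)e^{-2\pi i\langle t,x\rangle}\,dx$. Call $f\colon\mathbb{R}^n\to\mathbb{R}$ \emph{admissible} if it is continuous and there is $\varepsilon>0$ such that $|f(x)|=O\big((1+|x|)^{-n-\varepsilon}\big)$ and $|\widehat f(t)|=O\big((1+|t|)^{-n-\varepsilon}\big)$. Fix $\rho>0$. A packing $\mathcal{P}$ is a union of closed balls of radius $\rho$ in $\mathbb{R}^n$ with pairwise disjoint interiors, and the sphere packing density in $\mathbb{R}^n$ is \[ \Delta_n=\limsup_{r\to\infty}\ \sup_{\mathcal{P}}\ \frac{\operatorname{vol}(B_r(0)\cap\mathcal{P})}{\operatorname{vol}(B_r(0))}, \] where the supremum is over all such packings and $B_r(0)$ is the ball of radius $r$ centered at the origin. \textbf{Theorem (Cohn--Elkies linear programming bound).} Let $f\colon\mathbb{R}^n\to\mathbb{R}$ be an admissible function with $f(x)\le 0$ for $|x|\ge 2$, $\widehat f(t)\ge 0$ for all $t$ (in particular $\widehat f$ is real-valued), and $\widehat f(0)>0$. Then, for every common radius $\rho>0$,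 the sphere packing density satisfies \[ \Delta_n\le \frac{\pi^{n/2}}{\Gamma(n/2+1)}\cdot\frac{f(0)}{\widehat f(0)}, \] where $\pi^{n/2}/\Gamma(n/2+1)=\operatorname{vol}(B_1(0))$. -/

import Mathlib

open MeasureTheory Filter Topology Metric
open scoped FourierTransform ComplexOrder ENNReal

noncomputable section

namespace CohnElkies

/-- The Fourier transform of a real-valued function `f` on `ℝⁿ`, i.e.
`t ↦ ∫ f(x) exp(-2πi⟨t, x⟩) dx`. -/
def fourierTransform {n : ℕ} (f : EuclideanSpace ℝ (Fin n) → ℝ) :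
    EuclideanSpace ℝ (Fin n) → ℂ :=
  𝓕 (fun x => (f x : ℂ))

/-- The definition of the Fourier transform, written out as an integral. -/
theorem fourierTransform_apply {n : ℕ} (f : EuclideanSpace ℝ (Fin n) → ℝ)
    (t : EuclideanSpace ℝ (Fin n)) :
    fourierTransform f t =
      ∫ x, (f x : ℂ) * Complex.exp (-2 * Real.pi * Complex.I * (inner ℝ t x : ℝ)) := by
  unfold fourierTransform
  rw [Real.fourier_eq']
  refine integral_congr_ae (Eventually.of_forall fun x => ?_)
  simp only [smul_eq_mul, real_inner_comm t x]
  rw [mul_comm]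
  congr 2
  push_cast
  ring

/-- Admissible functions on `ℝⁿ`: continuous functions `f` such that both `f` and its Fourier
transform are `O((1 + |x|)^(-n-ε))` for some `ε > 0`. -/
structure Admissible {n : ℕ} (f : EuclideanSpace ℝ (Fin n) → ℝ) : Prop where
  continuous : Continuous f
  decay : ∃ ε > (0 : ℝ), ∃ C : ℝ,
    (∀ x, |f x| ≤ C * (1 + ‖x‖) ^ (-(n : ℝ) - ε)) ∧
    (∀ t, ‖fourierTransform f t‖ ≤ C * (1 + ‖t‖) ^ (-(n : ℝ) - ε))

/-- `X` is the set of centres of a packing by balls of radius `ρ`: the open balls of radius `ρ`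
(the interiors of the balls of the packing) around distinct points of `X` are disjoint. -/
def IsSpherePacking {n : ℕ} (ρ : ℝ) (X : Set (EuclideanSpace ℝ (Fin n))) : Prop :=
  X.PairwiseDisjoint (fun c => ball c ρ)

/-- The region covered by the (closed) balls of radius `ρ` with centres in `X`. -/
def coveredRegion {n : ℕ} (ρ : ℝ) (X : Set (EuclideanSpace ℝ (Fin n))) :
    Set (EuclideanSpace ℝ (Fin n)) :=
  ⋃ c ∈ X, closedBall c ρ

/-- The fraction of the ball of radius `r` centred at `x` that is covered by the balls of
radius `ρ` with centres in `X`. -/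
def localDensity {n : ℕ} (ρ : ℝ) (X : Set (EuclideanSpace ℝ (Fin n))) (r : ℝ)
    (x : EuclideanSpace ℝ (Fin n)) : ℝ≥0∞ :=
  volume (ball x r ∩ coveredRegion ρ X) / volume (ball x r)

/-- The optimal density of packings of `ℝⁿ` by congruent balls of radius `ρ`: the limsup, as
`r → ∞`, of the supremum over all such packings of the covered fraction of the ball of radius `r`
centred at the origin. -/
def spherePackingDensity (n : ℕ) (ρ : ℝ) : ℝ≥0∞ :=
  limsup (fun r : ℝ =>
    ⨆ X ∈ {X : Set (EuclideanSpace ℝ (Fin n)) | IsSpherePacking ρ X}, localDensity ρ X r 0) atTop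

end CohnElkies

end

/-!
The packing bound follows from positive definiteness, applied directly to finite pieces of an
arbitrary packing; neither periodic packings nor Poisson summation is needed.

By Fourier inversion `f` is the inverse Fourier transform of the nonnegative integrable function
`𝓕 f`, so for finite measures `α`, `β` Parseval's formula writes `∬ f (x - y) dα dβ` as an
integral against `𝓕 f`, and `∬ f (x - y) dμ dμ ≥ 0` for every signed measure `μ = α - c β`
(`integral_integral_sub_quadratic_nonneg`).

Let `X` be a set of `N` points of a large ball with mutual distances at least `2`. Take for `α` the
counting measure of `X`, for `β` Lebesgue measure on a slightly larger ball `B` of volume `V`, and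
`c = N / V`. The three terms of the quadratic form are estimated as follows:
* `∑ f (x - y)` over `X × X` is at most `N f(0)`, since off-diagonal terms are nonpositive;
* the mixed term is about `c N ∫ f`, since `B` contains a large ball about each point of `X`;
* the last term is about `c² V ∫ f`, up to the boundary layer of `B`.

Together these give `N ∫ f ≤ V f(0)` up to errors that vanish in the limit
(`card_mul_le_of_pairwise_dist`), where `∫ f` is the value of the Fourier transform at `0`.
Rescaling by `ρ` turns this count of centres into a bound for the covered fraction of a ball that
is uniform in the packing (`localDensity_le`). The radius then tends to infinity, and after it the
tail `ε` of `f` to zero.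
-/

namespace CohnElkies

/-! ### Positive definiteness from a nonnegative Fourier transform -/

section PositiveDefinite

variable {E : Type*} [NormedAddCommGroup E] [InnerProductSpace ℝ E] [MeasurableSpace E]

/-- The Fourier–Stieltjes transform `t ↦ ∫ exp(2πi⟨t, x⟩) dα(x)` of a measure. -/
noncomputable def charTransform (α : Measure E) (t : E) : ℂ :=
  ∫ x, (Real.fourierChar (inner ℝ t x) : ℂ) ∂α

lemma norm_charTransform_le (α : Measure E) [IsFiniteMeasure α] (t : E) :
    ‖charTransform α t‖ ≤ α.real Set.univ := by
  refine (norm_integral_le_integral_norm _).trans ?_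
  simp [Circle.norm_coe]

variable [BorelSpace E]

lemma continuous_charTransform (α : Measure E) [IsFiniteMeasure α] :
    Continuous (charTransform α) := by
  unfold charTransform
  refine continuous_of_dominated (bound := fun _ => 1) (fun t => ?_) (fun t => ?_) ?_ ?_
  · exact Continuous.aestronglyMeasurable (by fun_prop)
  · simp [Circle.norm_coe]
  · exact integrable_const _
  · exact Eventually.of_forall fun x => by fun_prop

variable [FiniteDimensional ℝ E]

lemma integrable_mul_charTransform {φ : E → ℂ} (hφ : Integrable φ) (α β : Measure E)
    [IsFiniteMeasure α] [IsFiniteMeasure β] :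
    Integrable fun t => φ t * (charTransform α t * (starRingEnd ℂ) (charTransform β t)) := by
  have hα := continuous_charTransform α
  have hβ := continuous_charTransform β
  refine hφ.mul_bdd (c := α.real Set.univ * β.real Set.univ) ?_ ?_
  · exact Continuous.aestronglyMeasurable (by fun_prop)
  · refine Eventually.of_forall fun t => ?_
    rw [norm_mul, RCLike.norm_conj]
    exact mul_le_mul (norm_charTransform_le α t) (norm_charTransform_le β t) (norm_nonneg _)
      measureReal_nonneg

/-- Parseval's formula for a pair of finite measures. -/
lemma integral_integral_fourierInv_sub {φ : E → ℂ} (hφ : Integrable φ) (α β : Measure E)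
    [IsFiniteMeasure α] [IsFiniteMeasure β] :
    ∫ x, ∫ y, 𝓕⁻ φ (x - y) ∂β ∂α =
      ∫ t, φ t * (charTransform α t * (starRingEnd ℂ) (charTransform β t)) := by
  have hint : Integrable (Function.uncurry fun (z : E × E) (t : E) =>
      φ t * ((Real.fourierChar (inner ℝ t z.1) : ℂ) *
        (starRingEnd ℂ) (Real.fourierChar (inner ℝ t z.2) : ℂ)))
      ((α.prod β).prod volume) := by
    have h1 : Integrable (fun p : (E × E) × E => φ p.2) ((α.prod β).prod volume) :=
      hφ.comp_snd _
    refine h1.mul_bdd (c := 1) ?_ ?_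
    · exact Continuous.aestronglyMeasurable (by fun_prop)
    · exact Eventually.of_forall fun p => by simp [Circle.norm_coe]
  have hinv : ∀ x y : E, 𝓕⁻ φ (x - y) = ∫ t, φ t * ((Real.fourierChar (inner ℝ t x) : ℂ) *
        (starRingEnd ℂ) (Real.fourierChar (inner ℝ t y) : ℂ)) := by
    intro x y
    rw [Real.fourierInv_eq]
    congr 1 with t
    rw [inner_sub_right, sub_eq_add_neg, AddChar.map_add_eq_mul, AddChar.map_neg_eq_inv,
      Circle.smul_def, Circle.coe_mul, Circle.coe_inv_eq_conj, smul_eq_mul, mul_comm]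
  simp_rw [hinv]
  rw [← integral_prod (μ := α) (ν := β) (fun z : E × E => ∫ t, φ t *
    ((Real.fourierChar (inner ℝ t z.1) : ℂ) *
        (starRingEnd ℂ) (Real.fourierChar (inner ℝ t z.2) : ℂ))) hint.integral_prod_left,
    integral_integral_swap hint]
  congr 1 with t
  rw [integral_const_mul, integral_prod_mul (fun x => (Real.fourierChar (inner ℝ t x) : ℂ))
    (fun y => (starRingEnd ℂ) (Real.fourierChar (inner ℝ t y) : ℂ)), integral_conj]
  rfl

variable {f : E → ℝ}

/-- Since `𝓕 f` is real, the real part can be taken inside the integral in Parseval's formula; in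
particular both mixed terms of the quadratic form of `f` are equal. -/
lemma integral_integral_sub_eq_integral_fourier (hc : Continuous f) (hi : Integrable f)
    (hF : Integrable (𝓕 fun x => (f x : ℂ))) (hpos : ∀ t, 0 ≤ 𝓕 (fun x => (f x : ℂ)) t)
    (α β : Measure E) [IsFiniteMeasure α] [IsFiniteMeasure β] :
    ∫ x, ∫ y, f (x - y) ∂β ∂α = ∫ t, (𝓕 (fun x => (f x : ℂ)) t).re *
      (charTransform α t * (starRingEnd ℂ) (charTransform β t)).re := by
  have h := integral_integral_fourierInv_sub hF α β
  rw [Continuous.fourierInv_fourier_eq (by fun_prop) hi.ofReal hF] at h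
  simp_rw [integral_complex_ofReal] at h
  have h' := congrArg Complex.re h
  rw [Complex.ofReal_re] at h'
  rw [h', ← RCLike.re_eq_complex_re, ← integral_re (integrable_mul_charTransform hF α β)]
  congr 1 with t
  rw [RCLike.re_eq_complex_re, Complex.mul_re, ← (Complex.nonneg_iff.mp (hpos t)).2]
  simp

/-- The quadratic form `(μ, ν) ↦ ∬ f (x - y) dμ dν` is nonnegative on the signed measure
`α - c β`. -/
lemma integral_integral_sub_quadratic_nonneg (hc : Continuous f) (hi : Integrable f)
    (hF : Integrable (𝓕 fun x => (f x : ℂ))) (hpos : ∀ t, 0 ≤ 𝓕 (fun x => (f x : ℂ)) t)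
    (α β : Measure E) [IsFiniteMeasure α] [IsFiniteMeasure β] (c : ℝ) :
    0 ≤ ∫ x, ∫ y, f (x - y) ∂α ∂α - 2 * c * ∫ x, ∫ y, f (x - y) ∂β ∂α +
      c ^ 2 * ∫ x, ∫ y, f (x - y) ∂β ∂β := by
  have hint : ∀ (μ ν : Measure E) [IsFiniteMeasure μ] [IsFiniteMeasure ν],
      Integrable fun t => (𝓕 (fun x => (f x : ℂ)) t).re *
        (charTransform μ t * (starRingEnd ℂ) (charTransform ν t)).re := by
    intro μ ν _ _
    refine (integrable_mul_charTransform hF μ ν).re.congr (Eventually.of_forall fun t => ?_)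
    simp only [RCLike.re_eq_complex_re]
    rw [Complex.mul_re, ← (Complex.nonneg_iff.mp (hpos t)).2]
    simp
  simp only [integral_integral_sub_eq_integral_fourier hc hi hF hpos]
  rw [← integral_const_mul, ← integral_const_mul,
    ← integral_sub (hint α α) ((hint α β).const_mul _)]
  refine le_of_le_of_eq ?_
    (integral_add ((hint α α).sub ((hint α β).const_mul _)) ((hint β β).const_mul _))
  refine integral_nonneg fun t => ?_
  have h0 : 0 ≤ (𝓕 (fun x => (f x : ℂ)) t).re := (Complex.nonneg_iff.mp (hpos t)).1
  have h1 : 0 ≤ (𝓕 (fun x => (f x : ℂ)) t).re *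
      Complex.normSq (charTransform α t - c * charTransform β t) :=
    mul_nonneg h0 (Complex.normSq_nonneg _)
  refine h1.trans_eq ?_
  simp only [Complex.normSq_apply, Complex.mul_re, Complex.conj_re, Complex.conj_im,
    Complex.sub_re, Complex.sub_im, Complex.mul_im, Complex.ofReal_re, Complex.ofReal_im]
  ring

end PositiveDefinite

/-! ### Counting well-separated points in a ball -/

section Counting

variable {E : Type*} [NormedAddCommGroup E] [InnerProductSpace ℝ E] [FiniteDimensional ℝ E]
  [MeasurableSpace E] [BorelSpace E] {f : E → ℝ}

lemma abs_setIntegral_sub_left_le (hi : Integrable f) (B : Set E) (x : E) :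
    |∫ y in B, f (x - y)| ≤ ∫ y, |f y| := by
  calc |∫ y in B, f (x - y)| ≤ ∫ y in B, |f (x - y)| := abs_integral_le_integral_abs
    _ ≤ ∫ y, |f (x - y)| := setIntegral_le_integral (hi.comp_sub_left x).abs
        (Eventually.of_forall fun _ => abs_nonneg _)
    _ = ∫ y, |f y| := integral_sub_left_eq_self (fun y => |f y|) volume x

/-- If the tail of `f` outside `ball 0 L` is at most `ε`, then integrating `y ↦ f (x - y)` only
over a set containing `ball x L` changes the integral by at most `ε`. -/
lemma abs_setIntegral_sub_left_sub_integral_le (hi : Integrable f) {L ε : ℝ}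
    (htail : ∫ y in (ball (0 : E) L)ᶜ, |f y| ≤ ε) {B : Set E} (hB : MeasurableSet B) {x : E}
    (hx : ball x L ⊆ B) : |(∫ y in B, f (x - y)) - ∫ y, f y| ≤ ε := by
  have hix : Integrable fun y => f (x - y) := hi.comp_sub_left x
  have hsplit : (∫ y in B, f (x - y)) + ∫ y in Bᶜ, f (x - y) = ∫ y, f y := by
    rw [integral_add_compl hB hix, integral_sub_left_eq_self]
  rw [← hsplit, sub_add_cancel_left, abs_neg]
  calc |∫ y in Bᶜ, f (x - y)| ≤ ∫ y in Bᶜ, |f (x - y)| := abs_integral_le_integral_abs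
    _ ≤ ∫ y in (ball x L)ᶜ, |f (x - y)| :=
        setIntegral_mono_set hix.abs.integrableOn
          (Eventually.of_forall fun _ => abs_nonneg _)
          (Set.compl_subset_compl.mpr hx).eventuallyLE
    _ = ∫ y in (ball (0 : E) L)ᶜ, |f y| := by
        rw [← integral_indicator measurableSet_ball.compl,
          ← integral_indicator measurableSet_ball.compl,
          ← integral_sub_left_eq_self (Set.indicator (ball (0 : E) L)ᶜ fun y => |f y|) volume x]
        congr 1 with y
        have : y ∈ (ball x L)ᶜ ↔ x - y ∈ (ball (0 : E) L)ᶜ := by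
          simp [dist_eq_norm, norm_sub_rev]
        by_cases hy : y ∈ (ball x L)ᶜ
        · rw [Set.indicator_of_mem hy, Set.indicator_of_mem (this.mp hy)]
        · rw [Set.indicator_of_notMem hy, Set.indicator_of_notMem (fun h => hy (this.mpr h))]
    _ ≤ ε := htail

lemma exists_setIntegral_compl_ball_le (hi : Integrable f) {ε : ℝ} (hε : 0 < ε) :
    ∃ L > 0, ∫ y in (ball (0 : E) L)ᶜ, |f y| ≤ ε := by
  have h := (aecover_ball (μ := (volume : Measure E)) (x := 0) (r := fun L : ℝ => L)
    tendsto_id).integral_tendsto_of_countably_generated hi.abs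
  obtain ⟨L, hL, hL0⟩ := ((h.eventually_const_lt (sub_lt_self _ hε)).and
    (eventually_gt_atTop 0)).exists
  refine ⟨L, hL0, ?_⟩
  have := integral_add_compl (measurableSet_ball (x := (0 : E)) (ε := L)) hi.abs
  linarith

lemma apply_zero_nonneg_of_fourier_nonneg (hc : Continuous f) (hi : Integrable f)
    (hF : Integrable (𝓕 fun x => (f x : ℂ))) (hpos : ∀ t, 0 ≤ 𝓕 (fun x => (f x : ℂ)) t) :
    0 ≤ f 0 := by
  have h := integral_integral_sub_quadratic_nonneg hc hi hF hpos (Measure.dirac 0)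
    (Measure.dirac 0) 0
  simpa using h

/-- An upper bound for the self-interaction of a large ball: the points
of `ball 0 R` see almost the whole integral of `f`, and the remaining boundary layer contributes
at most `∫ |f|` per unit of volume. -/
lemma setIntegral_setIntegral_sub_le (hc : Continuous f) (hi : Integrable f) {L ε R : ℝ}
    (hL : 0 < L) (htail : ∫ y in (ball (0 : E) L)ᶜ, |f y| ≤ ε) :
    ∫ x in ball (0 : E) (R + L), ∫ y in ball (0 : E) (R + L), f (x - y) ≤
      volume.real (ball (0 : E) R) * ((∫ y, f y) + ε) +
        (volume.real (ball (0 : E) (R + L)) - volume.real (ball (0 : E) R)) * ∫ y, |f y| := by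
  have hsub : ball (0 : E) R ⊆ ball 0 (R + L) := ball_subset_ball (by linarith)
  set B := ball (0 : E) (R + L) with hB
  have hm : StronglyMeasurable fun x => ∫ y in B, f (x - y) :=
    StronglyMeasurable.integral_prod_right (f := fun x y => f (x - y))
      (Continuous.stronglyMeasurable (by unfold Function.uncurry; fun_prop))
  have hint : IntegrableOn (fun x => ∫ y in B, f (x - y)) B :=
    IntegrableOn.of_bound measure_ball_lt_top hm.aestronglyMeasurable (∫ y, |f y|)
      (Eventually.of_forall fun x => abs_setIntegral_sub_left_le hi B x)
  have hunion : B = ball 0 R ∪ (B \ ball 0 R) := (Set.union_sdiff_cancel hsub).symm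
  have hd : MeasurableSet (B \ ball (0 : E) R) := measurableSet_ball.diff measurableSet_ball
  have hsplit : ∫ x in B, ∫ y in B, f (x - y) = (∫ x in ball (0 : E) R, ∫ y in B, f (x - y)) +
      ∫ x in B \ ball 0 R, ∫ y in B, f (x - y) := by
    rw [← setIntegral_union Set.disjoint_sdiff_right hd (hint.mono_set hsub)
      (hint.mono_set Set.sdiff_subset), ← hunion]
  rw [hsplit]
  refine add_le_add ?_ ?_
  · calc _ ≤ ∫ x in ball (0 : E) R, ((∫ y, f y) + ε) := by
          refine setIntegral_mono_on (hint.mono_set hsub)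
            (integrableOn_const measure_ball_lt_top.ne) measurableSet_ball fun x hx => ?_
          have hxB : ball x L ⊆ B := ball_subset_ball' (by
            rw [mem_ball] at hx; linarith)
          have := (abs_le.mp (abs_setIntegral_sub_left_sub_integral_le hi htail
            measurableSet_ball hxB)).2
          linarith
      _ = _ := by rw [setIntegral_const, smul_eq_mul]
  · rw [← measureReal_sdiff hsub measurableSet_ball]
    calc _ ≤ ∫ x in B \ ball (0 : E) R, ∫ y, |f y| :=
          setIntegral_mono_on (hint.mono_set Set.sdiff_subset)
            (integrableOn_const
              ((measure_mono Set.sdiff_subset).trans_lt measure_ball_lt_top).ne) hd fun x _ =>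
              (le_abs_self _).trans (abs_setIntegral_sub_left_le hi B x)
      _ = _ := by rw [setIntegral_const, smul_eq_mul]

/-- The linear programming bound for finite sets: up to boundary effects, a finite set in
`ball 0 R` whose points have mutual distance at least `2` has at most
`vol (ball 0 R) * f 0 / ∫ f` elements. It comes from the quadratic form of `f` on the counting
measure of the set minus a multiple of Lebesgue measure on `ball 0 (R + L)`. -/
lemma card_mul_le_of_pairwise_dist (hc : Continuous f) (hi : Integrable f)
    (hF : Integrable (𝓕 fun x => (f x : ℂ))) (hpos : ∀ t, 0 ≤ 𝓕 (fun x => (f x : ℂ)) t)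
    (hneg : ∀ x, 2 ≤ ‖x‖ → f x ≤ 0) {L ε R : ℝ} (hL : 0 < L) (hR : 0 < R)
    (htail : ∫ y in (ball (0 : E) L)ᶜ, |f y| ≤ ε)
    (X : Finset E) (hX : ∀ x ∈ X, x ∈ ball (0 : E) R)
    (hsep : ∀ x ∈ X, ∀ y ∈ X, x ≠ y → 2 ≤ dist x y) :
    X.card * ((∫ y, f y) - 3 * ε - (1 - volume.real (ball (0 : E) R) /
        volume.real (ball (0 : E) (R + L))) * ∫ y, |f y|) ≤
      volume.real (ball (0 : E) (R + L)) * f 0 := by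
  classical
  have hf0 : 0 ≤ f 0 := apply_zero_nonneg_of_fourier_nonneg hc hi hF hpos
  have hε : 0 ≤ ε := (integral_nonneg fun _ => abs_nonneg _).trans htail
  have hW := setIntegral_setIntegral_sub_le (R := R) hc hi hL htail
  have hVV : volume.real (ball (0 : E) R) ≤ volume.real (ball (0 : E) (R + L)) :=
    measureReal_mono (ball_subset_ball (by linarith)) measure_ball_lt_top.ne
  have hVpos : 0 < volume.real (ball (0 : E) (R + L)) :=
    ENNReal.toReal_pos (measure_ball_pos _ _ (by linarith)).ne' measure_ball_lt_top.ne
  rcases X.eq_empty_or_nonempty with rfl | hne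
  · simpa using mul_nonneg hVpos.le hf0
  have hN : (0 : ℝ) < X.card := by exact_mod_cast hne.card_pos
  set V := volume.real (ball (0 : E) (R + L))
  set V₀ := volume.real (ball (0 : E) R)
  set B := ball (0 : E) (R + L)
  set I := ∫ y, f y
  set A := ∫ y, |f y|
  set N : ℝ := (X.card : ℝ) with hNdef
  have : IsFiniteMeasure (volume.restrict B) :=
    isFiniteMeasure_restrict.mpr measure_ball_lt_top.ne
  -- The weight `N / V` gives both measures the same total mass `N`.
  have hq := integral_integral_sub_quadratic_nonneg hc hi hF hpos
    (∑ x ∈ X, Measure.dirac x) (volume.restrict B) (N / V)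
  have hdirac : ∀ g : E → ℝ, ∫ x, g x ∂(∑ x ∈ X, Measure.dirac x) = ∑ x ∈ X, g x := by
    intro g
    rw [integral_finsetSum_measure fun x _ => integrable_dirac (by simp)]
    simp
  simp only [hdirac] at hq
  -- Off-diagonal terms are nonpositive.
  have h1 : ∑ x ∈ X, ∑ y ∈ X, f (x - y) ≤ N * f 0 := by
    calc ∑ x ∈ X, ∑ y ∈ X, f (x - y) ≤ ∑ x ∈ X, f 0 := by
          refine Finset.sum_le_sum fun x hx => ?_
          rw [← Finset.add_sum_erase _ _ hx, sub_self, add_le_iff_nonpos_right]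
          refine Finset.sum_nonpos fun y hy => hneg _ ?_
          rw [← dist_eq_norm]
          exact hsep x hx y (Finset.mem_of_mem_erase hy) (Finset.ne_of_mem_erase hy).symm
      _ = N * f 0 := by simp [N]
  -- Every point of `X` is at distance at least `L` from the complement of `B`.
  have h2 : N * (I - ε) ≤ ∑ x ∈ X, ∫ y in B, f (x - y) := by
    rw [← nsmul_eq_mul]
    refine Finset.card_nsmul_le_sum _ _ _ fun x hx => ?_
    have hxB : ball x L ⊆ B := ball_subset_ball' (by
      have := hX x hx
      rw [mem_ball] at this; linarith)
    have := (abs_le.mp (abs_setIntegral_sub_left_sub_integral_le hi htail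
      measurableSet_ball hxB)).1
    linarith
  have hV0 : 0 ≤ V₀ := measureReal_nonneg
  set W := ∫ x in B, ∫ y in B, f (x - y)
  set S := ∑ x ∈ X, ∫ y in B, f (x - y)
  have hc0 : 0 ≤ N / V := by positivity
  have h3 : 0 ≤ N * f 0 - 2 * (N / V) * (N * (I - ε)) + (N / V) ^ 2 * W := by
    have := mul_le_mul_of_nonneg_left h2 (by positivity : 0 ≤ 2 * (N / V))
    linarith
  have h4 : 0 ≤ V * f 0 - 2 * (N * (I - ε)) + N * (W / V) := by
    have := mul_nonneg (by positivity : 0 ≤ V / N) h3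
    refine this.trans_eq ?_
    field_simp
  have hI : 0 ≤ I := by
    have h0 := (Complex.nonneg_iff.mp (hpos 0)).1
    rw [Real.fourier_eq] at h0
    simpa [integral_complex_ofReal] using h0
  have h5 : W / V ≤ I + ε + (1 - V₀ / V) * A := by
    rw [div_le_iff₀ hVpos]
    have hV1 : (1 - V₀ / V) * A * V = (V - V₀) * A := by field_simp
    have := mul_le_mul_of_nonneg_right hVV (add_nonneg hI hε)
    linarith
  have h6 := mul_le_mul_of_nonneg_left h5 hN.le
  linarith

end Counting

/-! ### From counting to density -/

section Density

variable {n : ℕ}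

lemma volume_real_ball_one (n : ℕ) :
    volume.real (ball (0 : EuclideanSpace ℝ (Fin n)) 1) =
      Real.pi ^ ((n : ℝ) / 2) / Real.Gamma ((n : ℝ) / 2 + 1) := by
  rcases n.eq_zero_or_pos with rfl | hn
  · rw [measureReal_def, volume_euclideanSpace_eq_dirac]
    simp
  · have : Nonempty (Fin n) := ⟨⟨0, hn⟩⟩
    have hG : 0 < Real.Gamma ((n : ℝ) / 2 + 1) := Real.Gamma_pos_of_pos (by positivity)
    rw [measureReal_def, EuclideanSpace.volume_ball, Fintype.card_fin, ENNReal.ofReal_one, one_pow,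
      one_mul, ENNReal.toReal_ofReal (by positivity), Real.sqrt_eq_rpow, ← Real.rpow_natCast,
      ← Real.rpow_mul Real.pi_nonneg]
    congr 2
    ring

lemma volume_real_ball_zero {R : ℝ} (hR : 0 < R) :
    volume.real (ball (0 : EuclideanSpace ℝ (Fin n)) R) =
      R ^ n * volume.real (ball (0 : EuclideanSpace ℝ (Fin n)) 1) := by
  rw [measureReal_def, Measure.addHaar_ball_of_pos _ _ hR, finrank_euclideanSpace_fin,
    ENNReal.toReal_mul, ENNReal.toReal_ofReal (by positivity), measureReal_def]

variable {f : EuclideanSpace ℝ (Fin n) → ℝ}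

lemma integrable_of_norm_le_one_add_norm_rpow {F : Type*} [NormedAddCommGroup F]
    {g : EuclideanSpace ℝ (Fin n) → F} (hg : Continuous g) {ε C : ℝ} (hε : 0 < ε)
    (h : ∀ x, ‖g x‖ ≤ C * (1 + ‖x‖) ^ (-(n : ℝ) - ε)) : Integrable g := by
  have hr : Integrable fun x : EuclideanSpace ℝ (Fin n) => (1 + ‖x‖) ^ (-((n : ℝ) + ε)) :=
    integrable_one_add_norm (by rw [finrank_euclideanSpace_fin]; linarith)
  refine (hr.const_mul C).mono' hg.aestronglyMeasurable (Eventually.of_forall fun x => ?_)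
  rw [neg_add']
  exact h x

lemma Admissible.integrable (hf : Admissible f) : Integrable f := by
  obtain ⟨ε, hε, C, h, -⟩ := hf.decay
  exact integrable_of_norm_le_one_add_norm_rpow hf.continuous hε h

lemma Admissible.integrable_fourierTransform (hf : Admissible f) :
    Integrable (fourierTransform f) := by
  obtain ⟨ε, hε, C, -, h⟩ := hf.decay
  refine integrable_of_norm_le_one_add_norm_rpow ?_ hε h
  exact VectorFourier.fourierIntegral_continuous Real.continuous_fourierChar
    continuous_inner hf.integrable.ofReal

lemma fourierTransform_zero_re (f : EuclideanSpace ℝ (Fin n) → ℝ) :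
    (fourierTransform f 0).re = ∫ x, f x := by
  rw [fourierTransform, Real.fourier_eq]
  simp [integral_complex_ofReal]

/-- Only the balls with centre in `ball 0 (r + ρ)` meet `ball 0 r`, so the covered fraction of
`ball 0 r` is controlled by the number of these centres. -/
lemma localDensity_le_of_card_le {ρ r M : ℝ} (hρ : 0 < ρ) (hr : 0 < r)
    (X : Set (EuclideanSpace ℝ (Fin n)))
    (hM : ∀ s : Finset (EuclideanSpace ℝ (Fin n)), ↑s ⊆ X ∩ ball 0 (r + ρ) → (s.card : ℝ) ≤ M) :
    localDensity ρ X r 0 ≤ ENNReal.ofReal (M * (ρ / r) ^ n) := by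
  have hM0 : 0 ≤ M := by simpa using hM ∅ (by simp)
  have hfin : (X ∩ ball 0 (r + ρ)).Finite := by
    by_contra hinf
    obtain ⟨s, hs, hcard⟩ := Set.Infinite.exists_subset_card_eq hinf (⌊M⌋₊ + 1)
    have := hM s hs
    rw [hcard] at this
    push_cast at this
    linarith [Nat.lt_floor_add_one M]
  have hcover : ball 0 r ∩ coveredRegion ρ X ⊆ ⋃ c ∈ hfin.toFinset, closedBall c ρ := by
    rintro x ⟨hx, hxX⟩
    simp only [coveredRegion, Set.mem_iUnion, exists_prop] at hxX
    obtain ⟨c, hc, hxc⟩ := hxX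
    simp only [Set.mem_iUnion, Set.Finite.mem_toFinset, exists_prop]
    refine ⟨c, ⟨hc, ?_⟩, hxc⟩
    rw [mem_ball] at hx ⊢
    rw [mem_closedBall'] at hxc
    linarith [dist_triangle c x 0]
  have hv0 : volume (ball (0 : EuclideanSpace ℝ (Fin n)) 1) ≠ 0 :=
    (measure_ball_pos _ _ one_pos).ne'
  have hvtop : volume (ball (0 : EuclideanSpace ℝ (Fin n)) 1) ≠ ⊤ := measure_ball_lt_top.ne
  have hnum : volume (ball 0 r ∩ coveredRegion ρ X) ≤
      ENNReal.ofReal (M * ρ ^ n) * volume (ball (0 : EuclideanSpace ℝ (Fin n)) 1) := by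
    calc _ ≤ ∑ c ∈ hfin.toFinset, volume (closedBall c ρ) :=
          (measure_mono hcover).trans (measure_biUnion_finset_le _ _)
      _ = ENNReal.ofReal (hfin.toFinset.card) *
          (ENNReal.ofReal (ρ ^ n) * volume (ball (0 : EuclideanSpace ℝ (Fin n)) 1)) := by
          simp [Measure.addHaar_closedBall _ _ hρ.le]
      _ ≤ ENNReal.ofReal M *
          (ENNReal.ofReal (ρ ^ n) * volume (ball (0 : EuclideanSpace ℝ (Fin n)) 1)) := by
          gcongr
          exact hM _ (by simp)
      _ = _ := by rw [ENNReal.ofReal_mul hM0, mul_assoc]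
  rw [localDensity, Measure.addHaar_ball_of_pos _ _ hr, finrank_euclideanSpace_fin]
  calc _ ≤ _ := ENNReal.div_le_div_right hnum _
    _ = ENNReal.ofReal (M * ρ ^ n) / ENNReal.ofReal (r ^ n) :=
        ENNReal.mul_div_mul_right _ _ hv0 hvtop
    _ = ENNReal.ofReal (M * (ρ / r) ^ n) := by
        rw [← ENNReal.ofReal_div_of_pos (by positivity), div_pow, mul_div_assoc]

/-- The bound for `card_mul_le_of_pairwise_dist` rescaled to packings by balls of radius `ρ`. -/
lemma localDensity_le (hf : Admissible f)
    (hneg : ∀ x, 2 ≤ ‖x‖ → f x ≤ 0) (hpos : ∀ t, 0 ≤ fourierTransform f t)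
    {ρ r L ε : ℝ} (hρ : 0 < ρ) (hr : 0 < r) (hL : 0 < L)
    (htail : ∫ y in (ball (0 : EuclideanSpace ℝ (Fin n)) L)ᶜ, |f y| ≤ ε)
    (hD : 0 < (∫ y, f y) - 3 * ε -
      (1 - ((r / ρ + 1) / (r / ρ + 1 + L)) ^ n) * ∫ y, |f y|)
    {X : Set (EuclideanSpace ℝ (Fin n))} (hX : IsSpherePacking ρ X) :
    localDensity ρ X r 0 ≤ ENNReal.ofReal
      (volume.real (ball (0 : EuclideanSpace ℝ (Fin n)) 1) * f 0 * (1 + (1 + L) * ρ / r) ^ n /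
        ((∫ y, f y) - 3 * ε -
          (1 - ((r / ρ + 1) / (r / ρ + 1 + L)) ^ n) * ∫ y, |f y|)) := by
  set D := (∫ y, f y) - 3 * ε - (1 - ((r / ρ + 1) / (r / ρ + 1 + L)) ^ n) * ∫ y, |f y| with hDdef
  set v := volume.real (ball (0 : EuclideanSpace ℝ (Fin n)) 1) with hv
  have hv0 : 0 < v :=
    ENNReal.toReal_pos (measure_ball_pos _ _ one_pos).ne' measure_ball_lt_top.ne
  have hR : 0 < r / ρ + 1 := by positivity
  have hRL : 0 < r / ρ + 1 + L := by positivity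
  refine (localDensity_le_of_card_le (M := (r / ρ + 1 + L) ^ n * v * f 0 / D) hρ hr X
    fun s hs => ?_).trans_eq ?_
  · have hinj : Function.Injective fun x : EuclideanSpace ℝ (Fin n) => ρ⁻¹ • x :=
      smul_right_injective _ (inv_ne_zero hρ.ne')
    have key := card_mul_le_of_pairwise_dist hf.continuous hf.integrable
      hf.integrable_fourierTransform hpos hneg hL hR htail
      (s.map ⟨_, hinj⟩) ?_ ?_
    · rw [Finset.card_map, volume_real_ball_zero hR, volume_real_ball_zero hRL, ← hv,
        mul_div_mul_right _ _ hv0.ne', ← div_pow, ← hDdef] at key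
      rwa [le_div_iff₀ hD]
    · intro x hx
      obtain ⟨c, hc, rfl⟩ := Finset.mem_map.mp hx
      have hcr : ‖c‖ < r + ρ := by simpa using (hs hc).2
      have : ‖ρ⁻¹ • c‖ < r / ρ + 1 := by
        rw [norm_smul, Real.norm_of_nonneg (by positivity), inv_mul_lt_iff₀ hρ]
        refine hcr.trans_eq ?_
        field_simp
      simpa using this
    · intro x hx y hy hxy
      obtain ⟨c, hc, rfl⟩ := Finset.mem_map.mp hx
      obtain ⟨d, hd, rfl⟩ := Finset.mem_map.mp hy
      have hcd : c ≠ d := fun h => hxy (by rw [h])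
      have hdist := (disjoint_ball_ball_iff hρ hρ).mp (hX (hs hc).1 (hs hd).1 hcd)
      change 2 ≤ dist (ρ⁻¹ • c) (ρ⁻¹ • d)
      rw [dist_smul₀, Real.norm_of_nonneg (by positivity), le_inv_mul_iff₀ hρ]
      linarith
  · congr 1
    have : (1 + (1 + L) * ρ / r) = (r / ρ + 1 + L) * (ρ / r) := by
      field_simp
      ring
    rw [this, mul_pow]
    ring

end Density

end CohnElkies

open CohnElkies

theorem mainTheorem1 (n : ℕ) (f : EuclideanSpace ℝ (Fin n) → ℝ)
    (hf : CohnElkies.Admissible f)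
    (hneg : ∀ x, 2 ≤ ‖x‖ → f x ≤ 0)
    (hpos : ∀ t, 0 ≤ CohnElkies.fourierTransform f t)
    (hzero : 0 < CohnElkies.fourierTransform f 0)
    (ρ : ℝ) (hρ : 0 < ρ) :
    CohnElkies.spherePackingDensity n ρ ≤
      ENNReal.ofReal (Real.pi ^ ((n : ℝ) / 2) / Real.Gamma ((n : ℝ) / 2 + 1) *
        (f 0 / (CohnElkies.fourierTransform f 0).re)) := by
  have hI : 0 < ∫ y, f y := by
    rw [← fourierTransform_zero_re]
    exact (Complex.pos_iff.mp hzero).1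
  rw [fourierTransform_zero_re, ← volume_real_ball_one, ← mul_div_assoc]
  set v := volume.real (ball (0 : EuclideanSpace ℝ (Fin n)) 1)
  set I := ∫ y, f y
  set A := ∫ y, |f y|
  -- For a fixed tail `ε`, the errors depending on the radius vanish in the limit.
  have hε : ∀ ε : ℝ, 0 < ε → 3 * ε < I →
      spherePackingDensity n ρ ≤ ENNReal.ofReal (v * f 0 / (I - 3 * ε)) := by
    intro ε hε hεI
    obtain ⟨L, hL, htail⟩ := exists_setIntegral_compl_ball_le hf.integrable hε
    have hR : Tendsto (fun r : ℝ => r / ρ + 1 + L) atTop atTop :=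
      tendsto_atTop_add_const_right _ _
        (tendsto_atTop_add_const_right _ _ (tendsto_id.atTop_div_const hρ))
    have hq : Tendsto (fun r : ℝ => (r / ρ + 1) / (r / ρ + 1 + L)) atTop (𝓝 1) := by
      have h1 : Tendsto (fun r : ℝ => 1 - L / (r / ρ + 1 + L)) atTop (𝓝 (1 - 0)) :=
        tendsto_const_nhds.sub (hR.const_div_atTop L)
      rw [sub_zero] at h1
      refine h1.congr' ?_
      filter_upwards [hR.eventually_gt_atTop 0] with r hr
      rw [one_sub_div hr.ne', add_sub_cancel_right]
    have hD : Tendsto (fun r : ℝ => I - 3 * ε - (1 - ((r / ρ + 1) / (r / ρ + 1 + L)) ^ n) * A)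
        atTop (𝓝 (I - 3 * ε)) := by
      have := tendsto_const_nhds (x := I - 3 * ε).sub
        (((tendsto_const_nhds (x := (1 : ℝ))).sub (hq.pow n)).mul_const A)
      simpa using this
    have hnum : Tendsto (fun r : ℝ => v * f 0 * (1 + (1 + L) * ρ / r) ^ n) atTop
        (𝓝 (v * f 0)) := by
      have := ((tendsto_const_nhds (x := (1 : ℝ))).add
        (tendsto_id.const_div_atTop ((1 + L) * ρ))).pow n |>.const_mul (v * f 0)
      simpa using this
    have hlim := ENNReal.tendsto_ofReal (hnum.div hD (sub_pos.mpr hεI).ne')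
    rw [spherePackingDensity, ← hlim.limsup_eq]
    refine limsup_le_limsup ?_
    filter_upwards [hD.eventually_const_lt (sub_pos.mpr hεI), eventually_gt_atTop 0] with r hDr hr
    exact iSup₂_le fun X hX => localDensity_le hf hneg hpos hρ hr hL htail hDr hX
  have hcont : Tendsto (fun ε : ℝ => ENNReal.ofReal (v * f 0 / (I - 3 * ε))) (𝓝[>] 0)
      (𝓝 (ENNReal.ofReal (v * f 0 / I))) := by
    refine ENNReal.tendsto_ofReal (tendsto_const_nhds.div ?_ hI.ne')
    have : Tendsto (fun ε : ℝ => I - 3 * ε) (𝓝 0) (𝓝 (I - 3 * 0)) :=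
      Continuous.tendsto (by fun_prop) 0
    rw [mul_zero, sub_zero] at this
    exact this.mono_left nhdsWithin_le_nhds
  refine ge_of_tendsto hcont ?_
  have hsmall : ∀ᶠ ε : ℝ in 𝓝[>] 0, ε < I / 3 :=
    nhdsWithin_le_nhds (eventually_lt_nhds (by positivity))
  filter_upwards [self_mem_nhdsWithin, hsmall] with ε hε0 hεI
  exact hε ε hε0 (by linarith)
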